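/- Proposition 3.1. Let $R$ be a commutative Noetherian ring and let $r\ge 0$ be an integer. For an ideal $\mathfrak a$ of a commutative Noetherian ring $A$, an $A$-module $M$ and $i\ge 0$, put $H^i_{\mathfrak a}(M)=\varinjlim_n \operatorname{Ext}^i_A(A/\mathfrak a^n,M)$. An $A$-module $L$ is called minimax if it has a finitely generated submodule $N$ such that $L/N$ is Artinian. For ideals $\mathfrak a,\mathfrak b$ of $A$ and a finitely generated $A$-module $M$, set $$f_{\mathfrak a}^{\mathfrak b}(M)=\inf\{i\ge 0 : \mathfrak b\not\subseteq \operatorname{Rad}(0:_A H^i_{\mathfrak a}(M))\},$$ and, when $\mathfrak b\subseteq\mathfrak a$, $$\mu_{\mathfrak a}^{\mathfrak b}(M)=\inf\{i\ge 1 : \mathfrak b^tH^i_{\mathfrak a}(M)\text{ is not minimax for all } t\ge 1\},$$ where $\inf\emptyset=\infty$. Suppose that the local-global principle for the minimaxness of local cohomology modules holds at level $r$ over $R$, i.e. for all ideals $\mathfrak b\subseteq\mathfrak a$ of $R$ and every finitely generated $R$-module $M$, $$\mu_{\mathfrak aR_{\mathfrak p}}^{\mathfrak bR_{\mathfrak p}}(M_{\mathfrak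 p})>r\ \text{ for all } \mathfrak p\in\operatorname{Spec}R \iff \mu_{\mathfrak a}^{\mathfrak b}(M)>r.$$ Then the local-global principle for the annihilation of local cohomology modules holds at level $r$ over $R$, i.e. for all ideals $\mathfrak a,\mathfrak b$ of $R$ and every finitely generated $R$-module $M$, $$f_{\mathfrak aR_{\mathfrak p}}^{\mathfrak bR_{\mathfrak p}}(M_{\mathfrak p})>r\ \text{ for all } \mathfrak p\in\operatorname{Spec}R \iff f_{\mathfrak a}^{\mathfrak b}(M)>r.$$ -/

import Mathlib

universe u

namespace MinimaxLC

/-- A module `L` is minimax if it has a finitely generated submodule `N` such that `L / N` is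
Artinian. -/
def IsMinimax (R : Type u) [CommRing R] (L : Type u) [AddCommGroup L] [Module R L] : Prop :=
  ∃ N : Submodule R L, N.FG ∧ IsArtinian R (L ⧸ N)

/-- The local cohomology module `H^i_a(M)`, the direct limit over `n` of `Ext^i(R / a ^ n, M)`. -/
noncomputable abbrev H {R : Type u} [CommRing R] (a : Ideal R) (i : ℕ)
    (M : Type u) [AddCommGroup M] [Module R M] : ModuleCat.{u} R :=
  (localCohomology a i).obj (ModuleCat.of R M)

/-- The `b`-finiteness dimension `f_a^b(M)` of `M` relative to `a`: the infimum in `ℕ ∪ {∞}` of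
the `i ≥ 0` for which `b` is not contained in the radical of the annihilator of `H^i_a(M)`. -/
noncomputable def finitenessDim {R : Type u} [CommRing R] (a b : Ideal R)
    (M : Type u) [AddCommGroup M] [Module R M] : ℕ∞ :=
  sInf {d : ℕ∞ | ∃ i : ℕ, d = i ∧ ¬ b ≤ (Module.annihilator R (H a i M)).radical}

/-- The `b`-minimaxness dimension `μ_a^b(M)` of `M` relative to `a`: the infimum in `ℕ ∪ {∞}` of
the `i ≥ 1` such that `b ^ t H^i_a(M)` is not minimax for all `t ≥ 1`. -/
noncomputable def minimaxDim {R : Type u} [CommRing R] (a b : Ideal R)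
    (M : Type u) [AddCommGroup M] [Module R M] : ℕ∞ :=
  sInf {d : ℕ∞ | ∃ i : ℕ, d = i ∧ 1 ≤ i ∧
    ∀ t : ℕ, 1 ≤ t → ¬ IsMinimax R ↥(b ^ t • (⊤ : Submodule R (H a i M)))}

/-- The extension `aR_p` of an ideal `a` of `R` to the local ring `R_p`. -/
noncomputable abbrev localIdeal {R : Type u} [CommRing R] (p : PrimeSpectrum R) (a : Ideal R) :
    Ideal (Localization.AtPrime p.asIdeal) :=
  a.map (algebraMap R (Localization.AtPrime p.asIdeal))

/-- The local-global principle for the minimaxness of local cohomology modules at level `r`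
over `R`. -/
def MinimaxPrinciple (R : Type u) [CommRing R] (r : ℕ) : Prop :=
  ∀ a b : Ideal R, b ≤ a → ∀ (M : Type u) [AddCommGroup M] [Module R M] [Module.Finite R M],
    (∀ p : PrimeSpectrum R,
      (r : ℕ∞) < minimaxDim (localIdeal p a) (localIdeal p b)
        (LocalizedModule p.asIdeal.primeCompl M)) ↔
    (r : ℕ∞) < minimaxDim a b M

/-- The local-global principle for the annihilation of local cohomology modules at level `r`
over `R`. -/
def AnnihilationPrinciple (R : Type u) [CommRing R] (r : ℕ) : Prop :=
  ∀ (a b : Ideal R) (M : Type u) [AddCommGroup M] [Module R M] [Module.Finite R M],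
    (∀ p : PrimeSpectrum R,
      (r : ℕ∞) < finitenessDim (localIdeal p a) (localIdeal p b)
        (LocalizedModule p.asIdeal.primeCompl M)) ↔
    (r : ℕ∞) < finitenessDim a b M

end MinimaxLC

/-!
Everything about `H^i_a` is reduced to torsion submodules by dimension shifting along
`0 → M → I → C → 0` with `I` injective:
`H^0_a = Γ_a`, the `a`-torsion; `H^1_a(M)` is the cokernel of `Γ_a(I) → Γ_a(C)`; and
`H^{i+2}_a(M) ≅ H^{i+1}_a(C)`. These come from a connecting map for `Ext`, natural in the first
variable (`leftDerivedδ`, `extδ`), which passes to the colimit over the powers of `a`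
(`exists_connecting`), together with the vanishing of `Ext` into an injective module.
Three facts then carry the argument.

* Local cohomology commutes with localization (`exists_linearEquiv_localizedModule_H`): over a
  Noetherian ring `Γ_a` does, and localizations of injective modules are injective.
* If `H^j_a(M)` is `b`-torsion for all `j ≤ i`, then `H^i_a(M) ≅ H^i_{a ⊔ b}(M)`
  (`exists_linearEquiv_H_sup`). Here `I` is chosen with `Γ_a(I)` being `b`-torsion, so that the
  hypothesis passes from `M` to `C` one degree lower. As being `b`-torsion is a local property,
  this replaces `a` by `a ⊔ b`, and the minimaxness principle, which needs `b ≤ a`, applies.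
* A minimax module whose localizations at primes are each killed by a power of `b` is itself killed
  by a power of `b` (`IsMinimax.exists_pow_smul_eq_zero`): a finitely generated submodule is
  `b`-torsion, and on an Artinian quotient the powers of `b` stabilize at a submodule that vanishes
  locally.

Given local annihilation up to degree `r`, local minimaxness is immediate (the zero module is
minimax), the principle gives that some `b ^ t H^i` is minimax for `1 ≤ i ≤ r`, and the third fact
above finishes the proof; in degree `0` the torsion submodule of `M` is itself finitely generated.
-/

open CategoryTheory Limits Opposite

universe v u' v'

namespace MinimaxLC

/-! ### Connecting maps for left derived functors -/

section LeftDerived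

variable {C : Type u} [Category.{v} C] [Abelian C]
  {D : Type u'} [Category.{v'} D] [Abelian D]

/-- The short complex of complexes obtained by applying `F₁ ⟶ F₂ ⟶ F₃` to a complex. -/
noncomputable abbrev complexSeq {F₁ F₂ F₃ : C ⥤ D} [F₁.Additive] [F₂.Additive] [F₃.Additive]
    (α : F₁ ⟶ F₂) (β : F₂ ⟶ F₃) (w : α ≫ β = 0) (K : ChainComplex C ℕ) :
    ShortComplex (ChainComplex D ℕ) :=
  ShortComplex.mk ((NatTrans.mapHomologicalComplex α _).app K)
    ((NatTrans.mapHomologicalComplex β _).app K) (by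
      ext i
      exact congr_app w (K.X i))

/-- The morphism of short complexes `complexSeq` induced by a chain map. -/
noncomputable abbrev complexSeqMap {F₁ F₂ F₃ : C ⥤ D} [F₁.Additive] [F₂.Additive] [F₃.Additive]
    (α : F₁ ⟶ F₂) (β : F₂ ⟶ F₃) (w : α ≫ β = 0) {K L : ChainComplex C ℕ} (φ : K ⟶ L) :
    complexSeq α β w K ⟶ complexSeq α β w L where
  τ₁ := (F₁.mapHomologicalComplex _).map φ
  τ₂ := (F₂.mapHomologicalComplex _).map φ
  τ₃ := (F₃.mapHomologicalComplex _).map φ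
  comm₁₂ := NatTrans.mapHomologicalComplex_naturality α φ
  comm₂₃ := NatTrans.mapHomologicalComplex_naturality β φ

variable {F₁ F₂ F₃ : C ⥤ D} [F₁.Additive] [F₂.Additive] [F₃.Additive]
    (α : F₁ ⟶ F₂) (β : F₂ ⟶ F₃) (w : α ≫ β = 0)
    (h : ∀ P : C, Projective P → (ShortComplex.mk (α.app P) (β.app P) (congr_app w P)).ShortExact)

include h in
lemma complexSeq_shortExact {X : C} (P : ProjectiveResolution X) :
    (complexSeq α β w P.complex).ShortExact :=
  HomologicalComplex.shortExact_of_degreewise_shortExact _ fun i => h (P.complex.X i) inferInstance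

lemma down_rel_succ (n : ℕ) : (ComplexShape.down ℕ).Rel (n + 1) n := by simp

/-- The connecting map in homology of the short exact sequence `complexSeq` on a projective
resolution. Source and target are written through `homologyFunctor`, in the form in which
`ProjectiveResolution.isoLeftDerivedObj` produces them. -/
noncomputable def complexδ (n : ℕ) {X : C} (P : ProjectiveResolution X) :
    (HomologicalComplex.homologyFunctor D _ (n + 1)).obj
      ((F₃.mapHomologicalComplex _).obj P.complex) ⟶
    (HomologicalComplex.homologyFunctor D _ n).obj
      ((F₁.mapHomologicalComplex _).obj P.complex) :=
  (complexSeq_shortExact α β w h P).δ (n + 1) n (down_rel_succ n)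

lemma complexδ_naturality (n : ℕ) {X Y : C} (P : ProjectiveResolution X)
    (Q : ProjectiveResolution Y) (φ : P.complex ⟶ Q.complex) :
    (F₃.mapHomologicalComplex _ ⋙ HomologicalComplex.homologyFunctor _ _ (n + 1)).map φ ≫
      complexδ α β w h n Q = complexδ α β w h n P ≫
    (F₁.mapHomologicalComplex _ ⋙ HomologicalComplex.homologyFunctor _ _ n).map φ :=
  (HomologicalComplex.HomologySequence.δ_naturality (complexSeqMap α β w φ)
    (complexSeq_shortExact α β w h _) (complexSeq_shortExact α β w h _) (n + 1) n
    (down_rel_succ n)).symm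

lemma complexδ_comp (n : ℕ) {X : C} (P : ProjectiveResolution X) :
    complexδ α β w h n P ≫ (HomologicalComplex.homologyFunctor D _ n).map
      ((NatTrans.mapHomologicalComplex α _).app P.complex) = 0 :=
  (complexSeq_shortExact α β w h P).δ_comp (n + 1) n (down_rel_succ n)

lemma complexδ_exact (n : ℕ) {X : C} (P : ProjectiveResolution X) :
    (ShortComplex.mk _ _ (complexδ_comp α β w h n P)).Exact :=
  (complexSeq_shortExact α β w h P).homology_exact₁ (n + 1) n (down_rel_succ n)

variable [EnoughProjectives C]

/-- The connecting map `L_{n+1} F₃ ⟶ L_n F₁` for natural transformations `F₁ ⟶ F₂ ⟶ F₃` which are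
short exact on projective objects; it is natural in the object. -/
noncomputable def leftDerivedδ (n : ℕ) : F₃.leftDerived (n + 1) ⟶ F₁.leftDerived n where
  app X := ((projectiveResolution X).isoLeftDerivedObj F₃ (n + 1)).hom ≫
    complexδ α β w h n (projectiveResolution X) ≫
      ((projectiveResolution X).isoLeftDerivedObj F₁ n).inv
  naturality X Y f := by
    have comm := ProjectiveResolution.lift_commutes_zero f (projectiveResolution X)
        (projectiveResolution Y)
    rw [ProjectiveResolution.isoLeftDerivedObj_hom_naturality_assoc f _ _ _ comm]
    simp only [Category.assoc]
    rw [ProjectiveResolution.isoLeftDerivedObj_inv_naturality f _ _ _ comm,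
      reassoc_of% complexδ_naturality α β w h n]
    rfl

lemma leftDerivedδ_comp_app (n : ℕ) (X : C) :
    (leftDerivedδ α β w h n).app X ≫ (NatTrans.leftDerived α n).app X = 0 := by
  rw [(projectiveResolution X).leftDerived_app_eq α]
  simp only [leftDerivedδ, Category.assoc, Iso.inv_hom_id_assoc]
  rw [reassoc_of% complexδ_comp α β w h n]
  simp

lemma leftDerivedδ_exact (n : ℕ) (X : C) :
    (ShortComplex.mk _ _ (leftDerivedδ_comp_app α β w h n X)).Exact := by
  refine (ShortComplex.exact_iff_of_iso ?_).2 (complexδ_exact α β w h n (projectiveResolution X))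
  refine ShortComplex.isoMk ((projectiveResolution X).isoLeftDerivedObj F₃ (n + 1))
    ((projectiveResolution X).isoLeftDerivedObj F₁ n)
    ((projectiveResolution X).isoLeftDerivedObj F₂ n) ?_ ?_
  · simp only [leftDerivedδ, Category.assoc, Iso.inv_hom_id, Category.comp_id]
  · simp only [(projectiveResolution X).leftDerived_app_eq α, Category.assoc, Iso.inv_hom_id,
      Category.comp_id]

lemma leftDerivedδ_mono (n : ℕ) (X : C) (h₂ : IsZero ((F₂.leftDerived (n + 1)).obj X)) :
    Mono ((leftDerivedδ α β w h n).app X) := by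
  have : Mono (complexδ α β w h n (projectiveResolution X)) :=
    (complexSeq_shortExact α β w h (projectiveResolution X)).mono_δ (n + 1) n (down_rel_succ n)
      (h₂.of_iso ((projectiveResolution X).isoLeftDerivedObj F₂ (n + 1)).symm)
  simp only [leftDerivedδ]
  infer_instance

end LeftDerived

/-! ### The long exact sequence of `Ext` and of local cohomology in the module variable -/

section Ext

variable {R : Type u} [CommRing R]

lemma comp_comp_eq_zero (S : ShortComplex (ModuleCat.{u} R)) {P : ModuleCat.{u} R}
    (x : P ⟶ S.X₁) : (x ≫ S.f) ≫ S.g = 0 := by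
  simp

lemma homSeq_shortExact {S : ShortComplex (ModuleCat.{u} R)} (hS : S.ShortExact)
    (P : ModuleCat.{u} R) [Projective P] :
    (ShortComplex.mk (((linearYoneda R (ModuleCat.{u} R)).map S.f).app (op P))
      (((linearYoneda R (ModuleCat.{u} R)).map S.g).app (op P)) (by
        ext x : 2
        exact comp_comp_eq_zero S x)).ShortExact := by
  have := hS.mono_f
  have := hS.epi_g
  refine ShortComplex.ShortExact.mk' ?_ ?_ ?_
  · rw [ShortComplex.moduleCat_exact_iff]
    intro (φ : P ⟶ S.X₂) (hφ : φ ≫ S.g = 0)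
    exact ⟨hS.exact.lift φ hφ, hS.exact.lift_f φ hφ⟩
  · rw [ModuleCat.mono_iff_injective]
    intro (φ : P ⟶ S.X₁) (ψ : P ⟶ S.X₁) (hφ : φ ≫ S.f = ψ ≫ S.f)
    exact (cancel_mono S.f).1 hφ
  · rw [ModuleCat.epi_iff_surjective]
    intro (φ : P ⟶ S.X₃)
    exact ⟨Projective.factorThru φ S.g, Projective.factorThru_comp φ S.g⟩

lemma isZero_Ext_succ_of_injective (Q I : ModuleCat.{u} R) [Injective I] (n : ℕ) :
    IsZero (((Ext R (ModuleCat.{u} R) (n + 1)).obj (op Q)).obj I) := by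
  let P := projectiveResolution Q
  refine IsZero.of_iso ?_ (P.isoExt (n + 1) I)
  rw [← HomologicalComplex.exactAt_iff_isZero_homology,
    HomologicalComplex.exactAt_iff' _ n (n + 1) (n + 2) (by simp) (by simp),
    ShortComplex.moduleCat_exact_iff]
  intro (φ : P.complex.X (n + 1) ⟶ I) (hφ : P.complex.d (n + 2) (n + 1) ≫ φ = 0)
  have := P.exact_succ n
  exact ⟨this.descToInjective φ hφ, this.comp_descToInjective φ hφ⟩

lemma linearYoneda_map_rightOp_comp (S : ShortComplex (ModuleCat.{u} R)) :
    NatTrans.rightOp ((linearYoneda R (ModuleCat.{u} R)).map S.g) ≫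
      NatTrans.rightOp ((linearYoneda R (ModuleCat.{u} R)).map S.f) = 0 := by
  ext P
  apply Quiver.Hom.unop_inj
  ext x : 2
  exact comp_comp_eq_zero S x

/-- The connecting map `Ext^n(Q, S.X₃) ⟶ Ext^{n+1}(Q, S.X₁)` of a short exact sequence `S`, natural
in `Q`. The functor `Ext` is left derived in its first variable with values in the opposite
category, so this is an instance of `leftDerivedδ` with the roles of the ends of `S` exchanged. -/
noncomputable def extδ {S : ShortComplex (ModuleCat.{u} R)} (hS : S.ShortExact) (n : ℕ) :
    (Ext R (ModuleCat.{u} R) n).flip.obj S.X₃ ⟶ (Ext R (ModuleCat.{u} R) (n + 1)).flip.obj S.X₁ :=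
  NatTrans.leftOp (leftDerivedδ
    (NatTrans.rightOp ((linearYoneda R (ModuleCat.{u} R)).map S.g))
    (NatTrans.rightOp ((linearYoneda R (ModuleCat.{u} R)).map S.f))
    (linearYoneda_map_rightOp_comp S) (fun P _ => (homSeq_shortExact hS P).op) n)

lemma extδ_exact {S : ShortComplex (ModuleCat.{u} R)} (hS : S.ShortExact) (n : ℕ)
    (Q : ModuleCat.{u} R) :
    Function.Exact (((Ext R (ModuleCat.{u} R) n).obj (op Q)).map S.g).hom
      ((extδ hS n).app (op Q)).hom :=
  (ShortComplex.ShortExact.moduleCat_exact_iff_function_exact _).1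
    (leftDerivedδ_exact
    (NatTrans.rightOp ((linearYoneda R (ModuleCat.{u} R)).map S.g))
    (NatTrans.rightOp ((linearYoneda R (ModuleCat.{u} R)).map S.f))
    (linearYoneda_map_rightOp_comp S) (fun P _ => (homSeq_shortExact hS P).op) n Q).unop

lemma extδ_surjective {S : ShortComplex (ModuleCat.{u} R)} (hS : S.ShortExact) [Injective S.X₂]
    (n : ℕ) (Q : ModuleCat.{u} R) :
    Function.Surjective ((extδ hS n).app (op Q)).hom := by
  rw [← ModuleCat.epi_iff_surjective]
  have := leftDerivedδ_mono
    (NatTrans.rightOp ((linearYoneda R (ModuleCat.{u} R)).map S.g))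
    (NatTrans.rightOp ((linearYoneda R (ModuleCat.{u} R)).map S.f))
    (linearYoneda_map_rightOp_comp S) (fun P _ => (homSeq_shortExact hS P).op) n Q
    (isZero_Ext_succ_of_injective Q S.X₂ n).op
  exact unop_epi_of_mono ((leftDerivedδ _ _ (linearYoneda_map_rightOp_comp S)
    (fun P _ => (homSeq_shortExact hS P).op) n).app Q)

/-- `Hom(-, Y)` turns colimits into limits. -/
instance (Y : ModuleCat.{u} R) :
    PreservesFiniteColimits ((linearYoneda R (ModuleCat.{u} R)).obj Y).rightOp := by
  have : PreservesLimits ((linearYoneda R (ModuleCat.{u} R)).obj Y) := by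
    have : PreservesLimits ((linearYoneda R (ModuleCat.{u} R)).obj Y ⋙ forget (ModuleCat R)) :=
      inferInstanceAs (PreservesLimits (yoneda.obj Y))
    exact preservesLimits_of_reflects_of_preserves _ (forget _)
  exact preservesFiniteColimits_rightOp _

open localCohomology

variable (a : Ideal R)

/-- `H^i_a(M)` is the colimit of the modules `Ext^i(R / a ^ n, M)`: the defining colimit is taken in
a functor category, and evaluation at `M` preserves it. -/
noncomputable def isColimitH (i : ℕ) (M : ModuleCat.{u} R) :
    IsColimit (((evaluation _ _).obj M).mapCocone
      (colimit.cocone (diagram (idealPowersDiagram a) i))) :=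
  isColimitOfPreserves ((evaluation _ _).obj M) (colimit.isColimit _)

/-- The module `R / a ^ n`, indexed as in the diagram defining local cohomology. -/
noncomputable abbrev stage (n : ℕᵒᵖᵒᵖ) : ModuleCat.{u} R :=
    (ringModIdeals (idealPowersDiagram a)).obj (unop n)

/-- The structure map `Ext^i(R / a ^ n, M) ⟶ H^i_a(M)` of the colimit. -/
noncomputable def ιH (i : ℕ) (M : ModuleCat.{u} R) (n : ℕᵒᵖᵒᵖ) :
    ((Ext R (ModuleCat.{u} R) i).obj (op (stage a n))).obj M ⟶ (localCohomology a i).obj M :=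
  (colimit.ι (diagram (idealPowersDiagram a) i) n).app M

lemma ιH_naturality (i : ℕ) {M N : ModuleCat.{u} R} (f : M ⟶ N) (n : ℕᵒᵖᵒᵖ) :
    ιH a i M n ≫ (localCohomology a i).map f =
      ((Ext R (ModuleCat.{u} R) i).obj (op (stage a n))).map f ≫ ιH a i N n :=
  ((colimit.ι (diagram (idealPowersDiagram a) i) n).naturality f).symm

lemma ιH_w (i : ℕ) (M : ModuleCat.{u} R) {m n : ℕᵒᵖᵒᵖ} (f : m ⟶ n) :
    ((Ext R (ModuleCat.{u} R) i).map ((ringModIdeals (idealPowersDiagram a)).map f.unop).op).app M ≫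
      ιH a i M n = ιH a i M m :=
  congr_app (colimit.w (diagram (idealPowersDiagram a) i) f) M

/-- The universe-adjusted form of the preservation of filtered colimits that applies to `ℕᵒᵖᵒᵖ`. -/
instance preservesColimit_forget {J : Type} [SmallCategory J] [IsFiltered J]
    (F : J ⥤ ModuleCat.{u} R) : PreservesColimit F (forget (ModuleCat.{u} R)) := by
  have := preservesFilteredColimitsOfSize_shrink.{0, u, 0, u} (forget (ModuleCat.{u} R))
  have := PreservesFilteredColimitsOfSize.preserves_filtered_colimits
    (F := forget (ModuleCat.{u} R)) J
  infer_instance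

lemma ιH_exists_rep (i : ℕ) (M : ModuleCat.{u} R) (x : (localCohomology a i).obj M) :
    ∃ n y, ιH a i M n y = x :=
  Concrete.isColimit_exists_rep _ (isColimitH a i M) x

lemma ιH_eq_zero (i : ℕ) (M : ModuleCat.{u} R) {n : ℕᵒᵖᵒᵖ} {x} (hx : ιH a i M n x = 0) :
    ∃ (m : ℕᵒᵖᵒᵖ) (f : n ⟶ m), ((Ext R (ModuleCat.{u} R) i).map
      ((ringModIdeals (idealPowersDiagram a)).map f.unop).op).app M x = 0 := by
  obtain ⟨k, f, g, h⟩ := (Concrete.isColimit_rep_eq_iff_exists _ (isColimitH a i M) x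
    (0 : ((Ext R (ModuleCat.{u} R) i).obj (op (stage a n))).obj M)).1
      (hx.trans (map_zero (ιH a i M n).hom).symm)
  refine ⟨k, f, h.trans (map_zero _)⟩

variable {a} in
lemma isZero_H_succ_of_injective (I : ModuleCat.{u} R) [Injective I] (n : ℕ)
    (x : (localCohomology a (n + 1)).obj I) : x = 0 := by
  obtain ⟨k, y, rfl⟩ := ιH_exists_rep a (n + 1) I x
  have := ModuleCat.subsingleton_of_isZero (isZero_Ext_succ_of_injective (stage a k) I n)
  rw [Subsingleton.elim y 0, map_zero]

/-- The exact sequence `H^i(X₂) → H^i(X₃) → H^{i+1}(X₁) → 0` of local cohomology for a short exact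
sequence whose middle term is injective. -/
lemma exists_connecting {S : ShortComplex (ModuleCat.{u} R)} (hS : S.ShortExact) [Injective S.X₂]
    (i : ℕ) : ∃ δ : (localCohomology a i).obj S.X₃ ⟶ (localCohomology a (i + 1)).obj S.X₁,
      Function.Surjective δ.hom ∧
      Function.Exact ((localCohomology a i).map S.g).hom δ.hom := by
  let c : Cocone (diagram (idealPowersDiagram a) i ⋙ (evaluation _ _).obj S.X₃) :=
    { pt := (localCohomology a (i + 1)).obj S.X₁
      ι := { app n := (extδ hS i).app (op (stage a n)) ≫ ιH a (i + 1) S.X₁ n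
             naturality m n f := by
               have h1 := (extδ hS i).naturality
                 ((ringModIdeals (idealPowersDiagram a)).map f.unop).op
               have h2 := ιH_w a (i + 1) S.X₁ f
               rw [← h2]
               exact ((reassoc_of% h1) _).trans (Category.comp_id _).symm } }
  let δ := (isColimitH a i S.X₃).desc c
  have hδ : ∀ n, ιH a i S.X₃ n ≫ δ = (extδ hS i).app (op (stage a n)) ≫ ιH a (i + 1) S.X₁ n :=
    fun n => (isColimitH a i S.X₃).fac c n
  have hδ' : ∀ n x, δ (ιH a i S.X₃ n x) =
      ιH a (i + 1) S.X₁ n ((extδ hS i).app (op (stage a n)) x) :=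
    fun n x => congr($(hδ n) x)
  have hg : ∀ n x, (localCohomology a i).map S.g (ιH a i S.X₂ n x) = ιH a i S.X₃ n
      (((Ext R (ModuleCat.{u} R) i).obj (op (stage a n))).map S.g x) :=
    fun n x => congr($(ιH_naturality a i S.g n) x)
  refine ⟨δ, ?_, ?_⟩
  · intro y
    obtain ⟨n, y, rfl⟩ := ιH_exists_rep a (i + 1) S.X₁ y
    obtain ⟨x, rfl⟩ := extδ_surjective hS i _ y
    exact ⟨_, hδ' n x⟩
  · intro y
    constructor
    · intro hy
      obtain ⟨n, y, rfl⟩ := ιH_exists_rep a i S.X₃ y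
      obtain ⟨m, f, hf⟩ := ιH_eq_zero a (i + 1) S.X₁ ((hδ' n y).symm.trans hy)
      have h1 := (extδ hS i).naturality ((ringModIdeals (idealPowersDiagram a)).map f.unop).op
      obtain ⟨z, hz⟩ := (extδ_exact hS i (stage a m) _).1 ((congr($h1 y)).trans hf)
      refine ⟨ιH a i S.X₂ m z, (hg m z).trans ?_⟩
      have h3 := congr($(ιH_w a i S.X₃ f) y)
      rw [← h3]
      exact congrArg (ιH a i S.X₃ m) hz
    · rintro ⟨z, rfl⟩
      obtain ⟨n, z, rfl⟩ := ιH_exists_rep a i S.X₂ z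
      refine (congrArg δ (hg n z)).trans ((hδ' n _).trans ?_)
      exact (congrArg _ ((extδ_exact hS i (stage a n)).apply_apply_eq_zero z)).trans (map_zero _)

end Ext

/-! ### Local cohomology in degree zero -/

/-- The comparison map `L_0 F ⟶ F` is natural in the functor `F`. -/
lemma leftDerived_comp_fromLeftDerivedZero {C : Type u} [Category.{v} C] [Abelian C]
    [EnoughProjectives C] {D : Type u'} [Category.{v'} D] [Abelian D] {F G : C ⥤ D} [F.Additive]
    [G.Additive] (α : F ⟶ G) (X : C) :
    (NatTrans.leftDerived α 0).app X ≫ G.fromLeftDerivedZero.app X =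
      F.fromLeftDerivedZero.app X ≫ α.app X := by
  let P := projectiveResolution X
  have key : HomologicalComplex.opcyclesMap
      ((NatTrans.mapHomologicalComplex α _).app P.complex) 0 ≫ P.fromLeftDerivedZero' G =
      P.fromLeftDerivedZero' F ≫ α.app X := by
    rw [← cancel_epi (HomologicalComplex.pOpcycles _ _)]
    rw [HomologicalComplex.p_opcyclesMap_assoc, P.pOpcycles_comp_fromLeftDerivedZero',
      P.pOpcycles_comp_fromLeftDerivedZero'_assoc]
    exact (α.naturality _).symm
  rw [P.leftDerived_app_eq α, P.fromLeftDerivedZero_eq, P.fromLeftDerivedZero_eq]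
  simp only [Category.assoc, Iso.inv_hom_id_assoc]
  congr 1
  refine Eq.trans ?_ ((congrArg (HomologicalComplex.homologyι _ 0 ≫ ·) key).trans
    (Category.assoc _ _ _).symm)
  exact HomologicalComplex.homologyι_naturality_assoc _ _ _

section
variable {R : Type u} [CommRing R]

/-- The `a`-torsion submodule `Γ_a(M)`: the elements killed by some power of `a`. -/
def Γ (a : Ideal R) (M : Type*) [AddCommGroup M] [Module R M] : Submodule R M where
  carrier := {x | ∃ n : ℕ, ∀ r ∈ a ^ n, r • x = 0}
  zero_mem' := ⟨0, fun r _ => smul_zero r⟩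
  add_mem' := by
    rintro x y ⟨m, hm⟩ ⟨n, hn⟩
    refine ⟨m + n, fun r hr => ?_⟩
    rw [smul_add, hm r (Ideal.pow_le_pow_right (Nat.le_add_right m n) hr),
      hn r (Ideal.pow_le_pow_right (Nat.le_add_left n m) hr), add_zero]
  smul_mem' := by
    rintro c x ⟨n, hn⟩
    exact ⟨n, fun r hr => by rw [smul_comm, hn r hr, smul_zero]⟩

/-- The isomorphism `Ext^0(Q, M) ≅ Hom(Q, M)`. -/
noncomputable def extZeroIso (Q M : ModuleCat.{u} R) :
    ((Ext R (ModuleCat.{u} R) 0).obj (op Q)).obj M ≅ ModuleCat.of R (Q ⟶ M) :=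
  (asIso (((linearYoneda R (ModuleCat.{u} R)).obj M).rightOp.fromLeftDerivedZero.app Q)).unop.symm

lemma extZeroIso_inv_naturality_left {Q Q' : ModuleCat.{u} R} (f : Q ⟶ Q')
    (M : ModuleCat.{u} R) (φ : Q' ⟶ M) :
    ((Ext R (ModuleCat.{u} R) 0).map f.op).app M ((extZeroIso Q' M).inv φ) =
      (extZeroIso Q M).inv (f ≫ φ) :=
  congr($(((linearYoneda R (ModuleCat.{u} R)).obj M).rightOp.fromLeftDerivedZero.naturality
    f).unop φ)

lemma extZeroIso_inv_naturality_right (Q : ModuleCat.{u} R) {M N : ModuleCat.{u} R}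
    (g : M ⟶ N) (φ : Q ⟶ M) :
    ((Ext R (ModuleCat.{u} R) 0).obj (op Q)).map g ((extZeroIso Q M).inv φ) =
      (extZeroIso Q N).inv (φ ≫ g) :=
  congr($(leftDerived_comp_fromLeftDerivedZero (NatTrans.rightOp
    ((linearYoneda R (ModuleCat.{u} R)).map g)) Q).unop φ)

/-- The map `Ext^0(R / J, M) ≅ Hom(R / J, M) ⟶ M` given by evaluation at `1`. -/
noncomputable def evOne (J : Ideal R) (M : ModuleCat.{u} R) :
    ((Ext R (ModuleCat.{u} R) 0).obj (op (ModuleCat.of R (R ⧸ J)))).obj M ⟶ M :=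
  (extZeroIso _ M).hom ≫ ModuleCat.ofHom
    { toFun := fun φ : ModuleCat.of R (R ⧸ J) ⟶ M => φ.hom (Ideal.Quotient.mk J 1)
      map_add' := fun _ _ => rfl
      map_smul' := fun _ _ => rfl }

lemma evOne_inv (J : Ideal R) (M : ModuleCat.{u} R) (φ : ModuleCat.of R (R ⧸ J) ⟶ M) :
    evOne J M ((extZeroIso _ M).inv φ) = φ.hom (Ideal.Quotient.mk J 1) :=
  congrArg (fun ψ : ModuleCat.of R (R ⧸ J) ⟶ M => ψ.hom (Ideal.Quotient.mk J 1))
    (congr($((extZeroIso (ModuleCat.of R (R ⧸ J)) M).inv_hom_id) φ))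

lemma extZeroIso_inv_surjective (Q M : ModuleCat.{u} R)
    (x : ((Ext R (ModuleCat.{u} R) 0).obj (op Q)).obj M) :
    ∃ φ : Q ⟶ M, (extZeroIso Q M).inv φ = x :=
  ⟨(extZeroIso Q M).hom x, congr($((extZeroIso Q M).hom_inv_id) x)⟩

lemma quotient_hom_ext {J : Ideal R} {M : ModuleCat.{u} R} {φ : ModuleCat.of R (R ⧸ J) ⟶ M}
    (h : φ.hom (Ideal.Quotient.mk J 1) = 0) : φ = 0 := by
  refine ModuleCat.hom_ext (LinearMap.ext fun x => ?_)
  obtain ⟨r, rfl⟩ := Ideal.Quotient.mk_surjective x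
  have : Ideal.Quotient.mk J r = r • Ideal.Quotient.mk J 1 := by
    rw [← Ideal.Quotient.mkₐ_eq_mk R, ← map_smul]; simp
  change φ.hom (Ideal.Quotient.mk J r) = 0
  rw [this, map_smul, h, smul_zero]

open localCohomology

/-- `H^0_a(M)` is identified with `Γ_a(M)` by an embedding into `M` which is natural in `M`. -/
theorem exists_eval (a : Ideal R) : ∃ ev : ∀ M : ModuleCat.{u} R, (localCohomology a 0).obj M ⟶ M,
    (∀ M, Function.Injective (ev M).hom) ∧ (∀ M, LinearMap.range (ev M).hom = Γ a M) ∧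
    ∀ (M N : ModuleCat.{u} R) (g : M ⟶ N), (localCohomology a 0).map g ≫ ev N = ev M ≫ g := by
  let c (M : ModuleCat.{u} R) :
      Cocone (diagram (idealPowersDiagram a) 0 ⋙ (evaluation _ _).obj M) :=
    { pt := M
      ι := { app n := evOne _ M
             naturality m n f := by
               ext x
               obtain ⟨φ, rfl⟩ := extZeroIso_inv_surjective (stage a m) M x
               refine (congrArg (evOne (a ^ n.unop.unop) M)
                 (extZeroIso_inv_naturality_left
                 ((ringModIdeals (idealPowersDiagram a)).map f.unop) M φ)).trans ?_
               refine (evOne_inv _ _ _).trans (Eq.trans ?_ (evOne_inv _ _ _).symm)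
               rfl } }
  let ev (M : ModuleCat.{u} R) := (isColimitH a 0 M).desc (c M)
  have hev (M : ModuleCat.{u} R) (n φ) : ev M (ιH a 0 M n ((extZeroIso (stage a n) M).inv φ)) =
      φ.hom (Ideal.Quotient.mk _ 1) :=
    (congr($((isColimitH a 0 M).fac (c M) n) _)).trans (evOne_inv _ _ φ)
  have rep (M : ModuleCat.{u} R) (x : (localCohomology a 0).obj M) :
      ∃ n φ, ιH a 0 M n ((extZeroIso (stage a n) M).inv φ) = x := by
    obtain ⟨n, y, rfl⟩ := ιH_exists_rep a 0 M x
    obtain ⟨φ, rfl⟩ := extZeroIso_inv_surjective (stage a n) M y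
    exact ⟨n, φ, rfl⟩
  refine ⟨ev, fun M => ?_, fun M => ?_, fun M N g => ?_⟩
  · rw [injective_iff_map_eq_zero]
    intro x hx
    obtain ⟨n, φ, rfl⟩ := rep M x
    obtain rfl := quotient_hom_ext ((hev M n φ).symm.trans hx)
    exact (congrArg _ (map_zero (extZeroIso (stage a n) M).inv.hom)).trans
      (map_zero (ιH a 0 M n).hom)
  · ext y
    constructor
    · rintro ⟨x, rfl⟩
      obtain ⟨n, φ, rfl⟩ := rep M x
      refine ⟨n.unop.unop, fun r hr => ?_⟩
      refine (congrArg (r • ·) (hev M n φ)).trans ((map_smul φ.hom r _).symm.trans ?_)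
      have : r • Ideal.Quotient.mk (a ^ n.unop.unop) 1 = 0 := by
        rw [← Ideal.Quotient.mkₐ_eq_mk R, ← map_smul]
        simpa [Ideal.Quotient.eq_zero_iff_mem] using hr
      exact (congrArg φ.hom this).trans (map_zero φ.hom)
    · rintro ⟨n, hn⟩
      let φ : ModuleCat.of R (R ⧸ a ^ n) ⟶ M := ModuleCat.ofHom
        (Submodule.liftQ (a ^ n) (LinearMap.toSpanSingleton R M y) (fun r hr => hn r hr))
      refine ⟨ιH a 0 M (op (op n)) ((extZeroIso (stage a (op (op n))) M).inv φ), ?_⟩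
      refine (hev M (op (op n)) φ).trans ?_
      exact one_smul R y
  · ext x
    obtain ⟨n, φ, rfl⟩ := rep M x
    have h1 := congr($(ιH_naturality a 0 g n) ((extZeroIso (stage a n) M).inv φ))
    refine (congrArg (ev N) h1).trans ?_
    refine (congrArg (fun z => ev N (ιH a 0 N n z))
      (extZeroIso_inv_naturality_right (stage a n) g φ)).trans ?_
    exact (hev N n _).trans (congrArg g (hev M n φ)).symm

end

/-! ### Localization of local cohomology -/

section Interface
variable {R : Type u} [CommRing R] (a : Ideal R)
  {M I C : Type u} [AddCommGroup M] [Module R M] [AddCommGroup I] [Module R I]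
  [AddCommGroup C] [Module R C]

/-- The map `Γ_a(M) → Γ_a(N)` induced by a linear map `M → N`. -/
def Γmap {M N : Type*} [AddCommGroup M] [Module R M] [AddCommGroup N] [Module R N] (g : M →ₗ[R] N) :
    Γ a M →ₗ[R] Γ a N :=
  g.restrict fun x ⟨n, hn⟩ => ⟨n, fun r hr => by rw [← map_smul, hn r hr, map_zero]⟩

@[simp] lemma coe_Γmap {M N : Type*} [AddCommGroup M] [Module R M] [AddCommGroup N] [Module R N]
    (g : M →ₗ[R] N) (x : Γ a M) : (Γmap a g x : N) = g x := rfl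

variable (M) in
theorem exists_injective_embedding : ∃ (I : Type u) (_ : AddCommGroup I) (_ : Module R I)
    (f : M →ₗ[R] I), Module.Injective R I ∧ Function.Injective f := by
  obtain ⟨⟨J, _, f, _⟩⟩ := (inferInstance : EnoughInjectives (ModuleCat.{u} R)).presentation
    (ModuleCat.of R M)
  exact ⟨J, inferInstance, inferInstance, f.hom, Module.injective_module_of_injective_object R J,
    (ModuleCat.mono_iff_injective f).1 inferInstance⟩

theorem exists_linearEquiv_H_zero : Nonempty (H a 0 M ≃ₗ[R] Γ a M) := by
  obtain ⟨ev, hinj, hrange, -⟩ := exists_eval a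
  exact ⟨(LinearEquiv.ofInjective _ (hinj (ModuleCat.of R M))).trans
    (LinearEquiv.ofEq _ _ (hrange (ModuleCat.of R M)))⟩

lemma shortExact_of_linearMaps {f : M →ₗ[R] I} {g : I →ₗ[R] C} (hf : Function.Injective f)
    (hg : Function.Surjective g) (hfg : Function.Exact f g) :
    (ShortComplex.mk (ModuleCat.ofHom f) (ModuleCat.ofHom g)
      (by ext x; exact hfg.apply_apply_eq_zero x)).ShortExact :=
  ModuleCat.shortComplex_shortExact _ hfg hf hg

/-- Dimension shifting in degrees at least two. -/
theorem exists_linearEquiv_H_add_two [hI : Module.Injective R I] {f : M →ₗ[R] I} {g : I →ₗ[R] C}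
    (hf : Function.Injective f) (hg : Function.Surjective g) (hfg : Function.Exact f g) (i : ℕ) :
    Nonempty (H a (i + 1) C ≃ₗ[R] H a (i + 2) M) := by
  have : Injective (ModuleCat.of R I) := Module.injective_object_of_injective_module R I
  obtain ⟨δ, hδ, hex⟩ := exists_connecting a (shortExact_of_linearMaps hf hg hfg) (i + 1)
  refine ⟨LinearEquiv.ofBijective δ.hom ⟨?_, hδ⟩⟩
  rw [injective_iff_map_eq_zero]
  intro x hx
  obtain ⟨y, rfl⟩ := (hex x).1 hx
  rw [isZero_H_succ_of_injective (ModuleCat.of R I) i y, map_zero]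

/-- Dimension shifting in degree one: `H^1_a(M)` is the cokernel of `Γ_a(I) → Γ_a(C)`. -/
theorem exists_surjective_H_one [hI : Module.Injective R I] {f : M →ₗ[R] I} {g : I →ₗ[R] C}
    (hf : Function.Injective f) (hg : Function.Surjective g) (hfg : Function.Exact f g) :
    ∃ γ : Γ a C →ₗ[R] H a 1 M, Function.Surjective γ ∧ Function.Exact (Γmap a g) γ := by
  have : Injective (ModuleCat.of R I) := Module.injective_object_of_injective_module R I
  obtain ⟨δ, hδ, hex⟩ := exists_connecting a (shortExact_of_linearMaps hf hg hfg) 0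
  obtain ⟨ev, hinj, hrange, hnat⟩ := exists_eval a
  let e (N : Type u) [AddCommGroup N] [Module R N] : H a 0 N ≃ₗ[R] Γ a N :=
    (LinearEquiv.ofInjective _ (hinj (ModuleCat.of R N))).trans
      (LinearEquiv.ofEq _ _ (hrange (ModuleCat.of R N)))
  have he (N : Type u) [AddCommGroup N] [Module R N] (x : H a 0 N) :
    (e N x : N) = (ev (ModuleCat.of R N)).hom x := rfl
  have hnat' (x : H a 0 I) : e C (((localCohomology a 0).map (ModuleCat.ofHom g)).hom x) =
      Γmap a g (e I x) := by
    ext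
    rw [coe_Γmap, he, he]
    exact congr($(hnat _ _ (ModuleCat.ofHom g)) x)
  refine ⟨δ.hom ∘ₗ (e C).symm.toLinearMap, hδ.comp (e C).symm.surjective, fun y => ?_⟩
  obtain ⟨y, rfl⟩ := (e C).surjective y
  have := hex y
  simp only [LinearMap.coe_comp, LinearEquiv.coe_coe, Function.comp_apply,
    LinearEquiv.symm_apply_apply]
  rw [this]
  constructor
  · rintro ⟨x, rfl⟩
    exact ⟨e I x, (hnat' x).symm⟩
  · rintro ⟨x, hx⟩
    obtain ⟨x, rfl⟩ := (e I).surjective x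
    exact ⟨x, (e C).injective ((hnat' x).trans hx)⟩

end Interface

section Localization

variable {R : Type u} [CommRing R] (S : Submonoid R)

/-- The localization of a linear map, as a map of modules over the localized ring. -/
noncomputable def locMap {M N : Type*} [AddCommGroup M] [Module R M] [AddCommGroup N]
    [Module R N] (g : M →ₗ[R] N) :
    LocalizedModule S M →ₗ[Localization S] LocalizedModule S N :=
  IsLocalizedModule.mapExtendScalars S (LocalizedModule.mkLinearMap S M)
    (LocalizedModule.mkLinearMap S N) (Localization S) g

@[simp] lemma locMap_mk {M N : Type*} [AddCommGroup M] [Module R M] [AddCommGroup N]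
    [Module R N] (g : M →ₗ[R] N) (m : M) (s : S) :
    locMap S g (LocalizedModule.mk m s) = LocalizedModule.mk (g m) s :=
  IsLocalizedModule.map_LocalizedModules S g m s

lemma locMap_injective {M N : Type*} [AddCommGroup M] [Module R M] [AddCommGroup N]
    [Module R N] {g : M →ₗ[R] N} (hg : Function.Injective g) : Function.Injective (locMap S g) :=
  IsLocalizedModule.map_injective S _ _ g hg

lemma locMap_surjective {M N : Type*} [AddCommGroup M] [Module R M] [AddCommGroup N]
    [Module R N] {g : M →ₗ[R] N} (hg : Function.Surjective g) : Function.Surjective (locMap S g) :=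
  IsLocalizedModule.map_surjective S _ _ g hg

lemma locMap_exact {M N P : Type*} [AddCommGroup M] [Module R M] [AddCommGroup N]
    [Module R N] [AddCommGroup P] [Module R P] {f : M →ₗ[R] N} {g : N →ₗ[R] P}
    (h : Function.Exact f g) : Function.Exact (locMap S f) (locMap S g) :=
  IsLocalizedModule.map_exact S _ _ _ f g h

lemma mk_eq_zero_iff {M : Type*} [AddCommGroup M] [Module R M] {m : M} {s : S} :
    LocalizedModule.mk m s = 0 ↔ ∃ t ∈ S, t • m = 0 := by
  rw [← LocalizedModule.zero_mk 1, LocalizedModule.mk_eq]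
  constructor
  · rintro ⟨u, hu⟩
    rw [one_smul, smul_zero, smul_zero] at hu
    exact ⟨u, u.2, hu⟩
  · rintro ⟨t, ht, h⟩
    refine ⟨⟨t, ht⟩, ?_⟩
    rw [one_smul, smul_zero, smul_zero]
    exact h

/-- If every element of a finitely generated submodule is killed by an element of `S`, then one
element of `S` kills the whole submodule. -/
lemma exists_smul_eq_zero_of_fg {M : Type*} [AddCommGroup M] [Module R M] {N : Submodule R M}
    (hN : N.FG) (h : ∀ x ∈ N, ∃ t ∈ S, t • x = 0) : ∃ t ∈ S, ∀ x ∈ N, t • x = 0 := by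
  classical
  obtain ⟨s, rfl⟩ := hN
  choose! t ht htx using fun x (hx : x ∈ s) => h x (Submodule.subset_span hx)
  refine ⟨∏ x ∈ s, t x, prod_mem fun x hx => ht x hx, fun x hx => ?_⟩
  induction hx using Submodule.span_induction with
  | mem x hx =>
    rw [← Finset.prod_erase_mul s t hx, mul_smul, htx x hx, smul_zero]
  | zero => exact smul_zero _
  | add x y _ _ hx hy => rw [smul_add, hx, hy, add_zero]
  | smul r x _ hx => rw [smul_comm, hx, smul_zero]

lemma exists_smul_eq_zero_of_ideal {M : Type*} [AddCommGroup M] [Module R M] {J : Ideal R}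
    (hJ : J.FG) (x : M) (h : ∀ r ∈ J, ∃ t ∈ S, t • r • x = 0) :
    ∃ t ∈ S, ∀ r ∈ J, t • r • x = 0 := by
  obtain ⟨t, ht, htx⟩ := exists_smul_eq_zero_of_fg S
    (Submodule.FG.map (LinearMap.toSpanSingleton R M x) hJ) (by
      rintro _ ⟨r, hr, rfl⟩
      exact h r hr)
  exact ⟨t, ht, fun r hr => htx _ ⟨r, hr, rfl⟩⟩

variable (a : Ideal R)

/-- The extension of an ideal to the localization at `S`; for the complement of a prime this is
`localIdeal`. -/
noncomputable abbrev locIdeal : Ideal (Localization S) := a.map (algebraMap R (Localization S))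

lemma smul_eq_zero_of_mem_map {A : Type*} [CommRing A] [Algebra R A] {M : Type*} [AddCommGroup M]
    [Module A M] {J : Ideal R} {x : M} (h : ∀ r ∈ J, algebraMap R A r • x = 0) :
    ∀ r ∈ J.map (algebraMap R A), r • x = 0 := by
  have : J.map (algebraMap R A) ≤ LinearMap.ker (LinearMap.toSpanSingleton A M x) :=
    Ideal.map_le_iff_le_comap.2 h
  exact this

lemma locMap_subtype_Γ_mem {M : Type*} [AddCommGroup M] [Module R M]
    (x : LocalizedModule S (Γ a M)) :
    locMap S (Γ a M).subtype x ∈ Γ (locIdeal S a) (LocalizedModule S M) := by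
  induction x using LocalizedModule.induction_on with
  | h m s =>
    obtain ⟨m, n, hn⟩ := m
    refine ⟨n, ?_⟩
    rw [← Ideal.map_pow]
    refine smul_eq_zero_of_mem_map fun r hr => ?_
    rw [locMap_mk, algebraMap_smul, LocalizedModule.smul'_mk]
    simp [hn r hr]

theorem locMap_Γ_surjective [IsNoetherianRing R] {M : Type*} [AddCommGroup M] [Module R M]
    {x : LocalizedModule S M} (hx : x ∈ Γ (locIdeal S a) (LocalizedModule S M)) :
    ∃ y, locMap S (Γ a M).subtype y = x := by
  induction x using LocalizedModule.induction_on with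
  | h m s =>
    obtain ⟨n, hn⟩ := hx
    rw [← Ideal.map_pow] at hn
    obtain ⟨t, ht, htm⟩ := exists_smul_eq_zero_of_ideal S (IsNoetherian.noetherian (a ^ n)) m
      (fun r hr => by
        have := hn _ (Ideal.mem_map_of_mem _ hr)
        rwa [algebraMap_smul, LocalizedModule.smul'_mk, mk_eq_zero_iff] at this)
    refine ⟨LocalizedModule.mk ⟨t • m, n, fun r hr => ?_⟩ (⟨t, ht⟩ * s), ?_⟩
    · rw [smul_comm, htm r hr]
    · rw [locMap_mk]
      exact LocalizedModule.mk_cancel_common_left ⟨t, ht⟩ s m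

/-- Over a Noetherian ring, `S⁻¹ Γ_a(M) ≅ Γ_{S⁻¹a}(S⁻¹M)`. -/
noncomputable def ΓLocEquiv [IsNoetherianRing R] (M : Type*) [AddCommGroup M] [Module R M] :
    LocalizedModule S (Γ a M) ≃ₗ[Localization S] Γ (locIdeal S a) (LocalizedModule S M) :=
  LinearEquiv.ofBijective ((locMap S (Γ a M).subtype).codRestrict _ (locMap_subtype_Γ_mem S a))
    ⟨fun _ _ hxy => locMap_injective S (Subtype.val_injective) (Subtype.ext_iff.1 hxy),
      fun ⟨_, hx⟩ => (locMap_Γ_surjective S a hx).imp fun _ hy => Subtype.ext hy⟩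

lemma ΓLocEquiv_naturality [IsNoetherianRing R] {M N : Type*} [AddCommGroup M] [Module R M]
    [AddCommGroup N] [Module R N] (g : M →ₗ[R] N) (x : LocalizedModule S (Γ a M)) :
    ΓLocEquiv S a N (locMap S (Γmap a g) x) =
      Γmap (locIdeal S a) (locMap S g) (ΓLocEquiv S a M x) := by
  induction x using LocalizedModule.induction_on with
  | h m s =>
    ext
    change locMap S (Γ a N).subtype (locMap S (Γmap a g) _) =
      locMap S g (locMap S (Γ a M).subtype _)
    rw [locMap_mk, locMap_mk, locMap_mk, locMap_mk]
    rfl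

/-- Over a Noetherian ring, localizations of injective modules are injective. By Baer's criterion it
suffices to extend maps from ideals; the contraction of an ideal is finitely presented, so a map
from it into `S⁻¹I` becomes, after multiplication by some `s ∈ S`, a map into `I`. -/
theorem injective_localizedModule [IsNoetherianRing R] (I : Type u) [AddCommGroup I] [Module R I]
    [hI : Module.Injective R I] : Module.Injective (Localization S) (LocalizedModule S I) := by
  refine Module.Baer.injective fun J φ => ?_
  let J₀ : Ideal R := J.comap (algebraMap R (Localization S))
  let ψ : J₀ →ₗ[R] LocalizedModule S I :=
    { toFun := fun r => φ ⟨algebraMap R (Localization S) r, r.2⟩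
      map_add' := fun r s => by
        rw [← map_add]; congr 1; ext; simp
      map_smul' := fun c r => by
        rw [RingHom.id_apply, ← algebraMap_smul (Localization S) c (φ _), ← map_smul]
        congr 1; ext; simp [Algebra.smul_def] }
  have := Module.finitePresentation_of_finite R J₀
  obtain ⟨θ, s, hθ⟩ := Module.FinitePresentation.exists_lift_of_isLocalizedModule S
    (LocalizedModule.mkLinearMap S I) ψ
  obtain ⟨θ', hθ'⟩ := Module.Baer.of_injective hI J₀ θ
  refine ⟨LinearMap.toSpanSingleton (Localization S) _ (LocalizedModule.mk (θ' 1) s),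
    fun x hx => ?_⟩
  obtain ⟨⟨r, t⟩, hrt⟩ := IsLocalization.surj S x
  have hr : r ∈ J₀ := by
    change algebraMap R (Localization S) r ∈ J
    rw [← hrt]
    exact J.mul_mem_right _ hx
  have h1 : s • φ ⟨algebraMap R (Localization S) r, hr⟩ = LocalizedModule.mk (θ ⟨r, hr⟩) 1 :=
    (congr($hθ ⟨r, hr⟩)).symm
  have h2 : (⟨algebraMap R (Localization S) r, hr⟩ : J) =
      algebraMap R (Localization S) t • ⟨x, hx⟩ := by
    ext; simp [← hrt, mul_comm, Algebra.smul_def]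
  rw [h2, map_smul, algebraMap_smul, ← hθ' r hr] at h1
  have h3 : θ' r = r • θ' 1 := by rw [← map_smul]; simp
  -- The claimed equality is checked after multiplication by the unit `s * t`.
  have h4 : Function.Injective fun y : LocalizedModule S I => (s * t : S) • y :=
    IsLocalizedModule.smul_injective (LocalizedModule.mkLinearMap S I) (s * t)
  apply h4
  dsimp only
  rw [LinearMap.toSpanSingleton_apply, mul_smul, mul_smul]
  refine Eq.trans ?_ h1.symm
  have h5 : t • (x • LocalizedModule.mk (θ' 1) s) = r • LocalizedModule.mk (θ' 1) s := by
    rw [← algebraMap_smul (Localization S) r, ← hrt, mul_comm, mul_smul, algebraMap_smul]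
    rfl
  have h6 : (s : R) • LocalizedModule.mk (θ' 1) s = LocalizedModule.mk (θ' 1) 1 := by
    rw [LocalizedModule.smul'_mk]
    exact LocalizedModule.mk_cancel s _
  rw [h5, h3, Submonoid.smul_def, smul_comm, h6, LocalizedModule.smul'_mk]

/-- Local cohomology over a Noetherian ring commutes with localization. -/
theorem exists_linearEquiv_localizedModule_H [IsNoetherianRing R] (i : ℕ) (M : Type u)
    [AddCommGroup M] [Module R M] :
    Nonempty (LocalizedModule S (H a i M) ≃ₗ[Localization S]
      H (locIdeal S a) i (LocalizedModule S M)) := by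
  have congrLoc {A B : Type u} [AddCommGroup A] [Module R A] [AddCommGroup B] [Module R B]
      (e : A ≃ₗ[R] B) : LocalizedModule S A ≃ₗ[Localization S] LocalizedModule S B :=
    IsLocalizedModule.mapEquiv S (LocalizedModule.mkLinearMap S A)
      (LocalizedModule.mkLinearMap S B) (Localization S) e
  induction i using Nat.twoStepInduction generalizing M with
  | zero =>
    obtain ⟨e⟩ := exists_linearEquiv_H_zero a (M := M)
    obtain ⟨e'⟩ := exists_linearEquiv_H_zero (locIdeal S a) (M := LocalizedModule S M)
    exact ⟨(congrLoc e).trans ((ΓLocEquiv S a M).trans e'.symm)⟩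
  | one =>
    obtain ⟨I, _, _, f, hI, hf⟩ := exists_injective_embedding (R := R) M
    have hg := (LinearMap.range f).mkQ_surjective
    have hfg := LinearMap.exact_map_mkQ_range f
    have := injective_localizedModule S I
    obtain ⟨γ, hγ, hex⟩ := exists_surjective_H_one a hf hg hfg
    obtain ⟨γ', hγ', hex'⟩ := exists_surjective_H_one (locIdeal S a) (locMap_injective S hf)
      (locMap_surjective S hg) (locMap_exact S hfg)
    have hexS := locMap_exact S hex
    have hker : LinearMap.ker (locMap S γ) =
        LinearMap.ker (γ' ∘ₗ (ΓLocEquiv S a (I ⧸ LinearMap.range f)).toLinearMap) := by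
      ext x
      simp only [LinearMap.mem_ker, LinearMap.coe_comp, Function.comp_apply, LinearEquiv.coe_coe]
      rw [hexS x, hex' _]
      constructor
      · rintro ⟨y, rfl⟩
        exact ⟨ΓLocEquiv S a I y, (ΓLocEquiv_naturality S a _ y).symm⟩
      · rintro ⟨y, hy⟩
        obtain ⟨y, rfl⟩ := (ΓLocEquiv S a I).surjective y
        exact ⟨y, (ΓLocEquiv S a _).injective ((ΓLocEquiv_naturality S a _ y).trans hy)⟩
    exact ⟨((LinearMap.quotKerEquivOfSurjective _ (locMap_surjective S hγ)).symm.trans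
      (Submodule.quotEquivOfEq _ _ hker)).trans (LinearMap.quotKerEquivOfSurjective _
        (hγ'.comp (ΓLocEquiv S a _).surjective))⟩
  | more i _ ih =>
    obtain ⟨I, _, _, f, hI, hf⟩ := exists_injective_embedding (R := R) M
    have hg := (LinearMap.range f).mkQ_surjective
    have hfg := LinearMap.exact_map_mkQ_range f
    have := injective_localizedModule S I
    obtain ⟨e⟩ := exists_linearEquiv_H_add_two a hf hg hfg i
    obtain ⟨e'⟩ := exists_linearEquiv_H_add_two (locIdeal S a) (locMap_injective S hf)
      (locMap_surjective S hg) (locMap_exact S hfg) i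
    obtain ⟨e''⟩ := ih (I ⧸ LinearMap.range f)
    exact ⟨(congrLoc e.symm).trans (e''.trans e')⟩

end Localization

/-! ### Enlarging the support ideal by an ideal of torsion -/

section Torsion
variable {R : Type u} [CommRing R] {a b c : Ideal R}
  {M N : Type*} [AddCommGroup M] [Module R M] [AddCommGroup N] [Module R N]

lemma Γ_anti (h : a ≤ c) : Γ c M ≤ Γ a M :=
  fun _ ⟨n, hn⟩ => ⟨n, fun r hr => hn r (Ideal.pow_right_mono h n hr)⟩

lemma map_mem_Γ (f : M →ₗ[R] N) {x : M} (hx : x ∈ Γ a M) : f x ∈ Γ a N :=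
  (Γmap a f ⟨x, hx⟩).2

lemma mem_Γ_of_injective {f : M →ₗ[R] N} (hf : Function.Injective f) {x : M}
    (hx : f x ∈ Γ a N) : x ∈ Γ a M := by
  obtain ⟨n, hn⟩ := hx
  exact ⟨n, fun r hr => hf (by rw [map_smul, hn r hr, map_zero])⟩

lemma Γ_eq_Γ_sup (h : Γ a M ≤ Γ b M) : Γ a M = Γ (a ⊔ b) M := by
  refine le_antisymm (fun x hx => ?_) (Γ_anti le_sup_left)
  obtain ⟨n, hn⟩ := h hx
  obtain ⟨m, hm⟩ := hx
  refine ⟨m + n, fun r hr => ?_⟩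
  obtain ⟨s, hs, t, ht, rfl⟩ := Submodule.mem_sup.1 (Ideal.sup_pow_add_le_pow_sup_pow hr)
  rw [add_smul, hm s hs, hn t ht, add_zero]

lemma exists_pow_smul_eq_zero_of_fg {L : Submodule R M} (hL : L.FG) (h : L ≤ Γ a M) :
    ∃ n : ℕ, ∀ r ∈ a ^ n, ∀ x ∈ L, r • x = 0 := by
  obtain ⟨s, rfl⟩ := hL
  choose! k hk using fun x (hx : x ∈ s) => h (Submodule.subset_span hx)
  refine ⟨s.sup k, fun r hr x hx => ?_⟩
  induction hx using Submodule.span_induction with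
  | mem x hx => exact hk x hx r (Ideal.pow_le_pow_right (Finset.le_sup (f := k) hx) hr)
  | zero => exact smul_zero _
  | add x y _ _ hx hy => rw [smul_add, hx, hy, add_zero]
  | smul s x _ hx => rw [smul_comm, hx, smul_zero]

lemma mem_Γ_of_forall_pow [IsNoetherianRing R] {n : ℕ} {x : M} (h : ∀ r ∈ a ^ n, r • x ∈ Γ a M) :
    x ∈ Γ a M := by
  obtain ⟨m, hm⟩ := exists_pow_smul_eq_zero_of_fg (a := a)
    (Submodule.FG.map (LinearMap.toSpanSingleton R M x) (IsNoetherian.noetherian (a ^ n)))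
    (by rintro _ ⟨r, hr, rfl⟩; exact h r hr)
  refine ⟨m + n, fun r hr => ?_⟩
  rw [pow_add] at hr
  have : a ^ m * a ^ n ≤ LinearMap.ker (LinearMap.toSpanSingleton R M x) :=
    Ideal.mul_le.2 fun s hs t ht => by
      have := hm s hs _ ⟨t, ht, rfl⟩
      simpa [mul_smul] using this
  exact this hr

lemma mem_Γ_of_mkQ_mem [IsNoetherianRing R] {x : M} (h : (Γ a M).mkQ x ∈ Γ a (M ⧸ Γ a M)) :
    x ∈ Γ a M := by
  obtain ⟨n, hn⟩ := h
  refine mem_Γ_of_forall_pow (n := n) fun r hr => ?_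
  rw [← (Submodule.Quotient.mk_eq_zero (Γ a M))]
  exact hn r hr

end Torsion

section Injective
variable {R : Type u} [CommRing R]

lemma exists_extension_of_ker_le {J X Y : Type u} [AddCommGroup J] [Module R J]
    [hJ : Module.Injective R J]
    [AddCommGroup X] [Module R X] [AddCommGroup Y] [Module R Y] (f : X →ₗ[R] Y) (g : X →ₗ[R] J)
    (h : LinearMap.ker f ≤ LinearMap.ker g) : ∃ k : Y →ₗ[R] J, ∀ x, k (f x) = g x := by
  obtain ⟨k, hk⟩ := hJ.out ((LinearMap.ker f).liftQ f le_rfl)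
    (LinearMap.ker_eq_bot.1 (Submodule.ker_liftQ_eq_bot _ _ _ le_rfl)) ((LinearMap.ker f).liftQ g h)
  exact ⟨k, fun x => hk (Submodule.Quotient.mk x)⟩

/-- Over a Noetherian ring, `Γ_c(J)` is injective when `J` is. A map `g` from an ideal `A` to
`Γ_c(J)` is killed by `c ^ n`, hence vanishes on `A ⊓ c ^ (n + k)` by the Artin-Rees lemma, and so
extends to a map that factors through `R / c ^ (n + k)`. -/
instance injective_Γ [IsNoetherianRing R] (c : Ideal R) (J : Type u) [AddCommGroup J] [Module R J]
    [hJ : Module.Injective R J] : Module.Injective R (Γ c J) := by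
  refine Module.Baer.injective fun A g => ?_
  obtain ⟨n, hn⟩ := exists_pow_smul_eq_zero_of_fg (a := c) (M := J)
    (L := (LinearMap.range ((Γ c J).subtype ∘ₗ g)))
    (by rw [LinearMap.range_eq_map]; exact Submodule.FG.map _ (IsNoetherian.noetherian _))
    (by rintro _ ⟨x, rfl⟩; exact (g x).2)
  obtain ⟨k, hk⟩ := Ideal.exists_pow_inf_eq_pow_smul c A
  have hker : LinearMap.ker ((c ^ (n + k)).mkQ ∘ₗ A.subtype) ≤
      LinearMap.ker ((Γ c J).subtype ∘ₗ g) := by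
    rintro ⟨x, hxA⟩ hx
    have hx' : x ∈ c ^ (n + k) := (Submodule.Quotient.mk_eq_zero _).1 hx
    have h1 : x ∈ c ^ n • A := by
      have h2 : x ∈ c ^ (n + k) • (⊤ : Submodule R R) ⊓ A := ⟨by simpa using hx', hxA⟩
      rw [hk _ (Nat.le_add_left k n), Nat.add_sub_cancel] at h2
      exact Submodule.smul_mono le_rfl inf_le_right h2
    have h3 : c ^ n • A ≤ Submodule.map A.subtype (LinearMap.ker ((Γ c J).subtype ∘ₗ g)) :=
      Submodule.smul_le.2 fun r hr y hy => ⟨r • ⟨y, hy⟩, by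
        rw [SetLike.mem_coe, LinearMap.mem_ker, map_smul]
        exact hn r hr _ ⟨_, rfl⟩, rfl⟩
    obtain ⟨z, hz, hzx⟩ := h3 h1
    rwa [show (⟨x, hxA⟩ : A) = z from Subtype.ext hzx.symm]
  obtain ⟨h, hh⟩ := exists_extension_of_ker_le _ _ hker
  have hmem : ∀ x, (h ∘ₗ (c ^ (n + k)).mkQ) x ∈ Γ c J := fun x => by
    refine ⟨n + k, fun r hr => ?_⟩
    rw [← map_smul, LinearMap.comp_apply, ← map_zero h]
    congr 1
    exact (Submodule.Quotient.mk_eq_zero _).2 (Ideal.mul_mem_right x _ hr)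
  exact ⟨(h ∘ₗ (c ^ (n + k)).mkQ).codRestrict _ hmem, fun x hx => Subtype.ext (hh ⟨x, hx⟩)⟩

lemma injective_of_retract {I K : Type u} [AddCommGroup I] [Module R I] [AddCommGroup K]
    [Module R K] [hI : Module.Injective R I] (i : K →ₗ[R] I) (p : I →ₗ[R] K)
    (h : ∀ x, p (i x) = x) : Module.Injective R K where
  out X Y _ _ _ _ f hf g := by
    obtain ⟨k, hk⟩ := hI.out f hf (i ∘ₗ g)
    exact ⟨p ∘ₗ k, fun x => by simp [hk, h]⟩

lemma injective_quotient {I : Type u} [AddCommGroup I] [Module R I] [Module.Injective R I]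
    (N : Submodule R I) [hN : Module.Injective R N] : Module.Injective R (I ⧸ N) := by
  obtain ⟨ρ, hρ⟩ := hN.out N.subtype N.injective_subtype LinearMap.id
  refine injective_of_retract (I := I)
    (N.liftQ (LinearMap.id - N.subtype ∘ₗ ρ) fun x hx => ?_) N.mkQ fun x => ?_
  · have := congrArg Subtype.val (hρ ⟨x, hx⟩)
    exact sub_eq_zero.2 this.symm
  · obtain ⟨x, rfl⟩ := N.mkQ_surjective x
    change N.mkQ (x - ρ x) = N.mkQ x
    rw [map_sub, sub_eq_self]
    exact (Submodule.Quotient.mk_eq_zero N).2 (ρ x).2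

lemma injective_prod {I K : Type u} [AddCommGroup I] [Module R I] [AddCommGroup K]
    [Module R K] [hI : Module.Injective R I] [hK : Module.Injective R K] :
    Module.Injective R (I × K) where
  out X Y _ _ _ _ f hf g := by
    obtain ⟨k, hk⟩ := hI.out f hf (LinearMap.fst R I K ∘ₗ g)
    obtain ⟨l, hl⟩ := hK.out f hf (LinearMap.snd R I K ∘ₗ g)
    exact ⟨k.prod l, fun x => Prod.ext (hk x) (hl x)⟩

/-- If `Γ_a(M)` is `b`-torsion, then `M` embeds in an injective module `I` such that `Γ_a(I)`
is `b`-torsion. This takes the place of the injective hull: `I` is the product of an injective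
`b`-torsion module containing `Γ_a(M)` and an injective module without `a`-torsion containing
`M / Γ_a(M)`. -/
theorem exists_injective_embedding_Γ_le [IsNoetherianRing R] (a b : Ideal R) (M : Type u)
    [AddCommGroup M] [Module R M] (h : Γ a M ≤ Γ b M) :
    ∃ (I : Type u) (_ : AddCommGroup I) (_ : Module R I) (f : M →ₗ[R] I),
      Module.Injective R I ∧ Function.Injective f ∧ Γ a I ≤ Γ b I := by
  obtain ⟨J, _, _, j, hJ, hj⟩ := exists_injective_embedding (R := R) (Γ a M)
  obtain ⟨K, _, _, k, hK, hk⟩ := exists_injective_embedding (R := R) (M ⧸ Γ a M)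
  have hj' (x : Γ a M) : j x ∈ Γ b J :=
    map_mem_Γ j (mem_Γ_of_injective (Γ a M).injective_subtype (h x.2))
  obtain ⟨f₁, hf₁⟩ := (injective_Γ b J).out (Γ a M).subtype (Γ a M).injective_subtype
    (j.codRestrict _ hj')
  have := injective_quotient (Γ a K)
  refine ⟨Γ b J × (K ⧸ Γ a K), inferInstance, inferInstance,
    f₁.prod ((Γ a K).mkQ ∘ₗ k ∘ₗ (Γ a M).mkQ), injective_prod, ?_, ?_⟩
  · rw [injective_iff_map_eq_zero]
    intro x hx
    have h1 : f₁ x = 0 := congrArg Prod.fst hx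
    have h2 : k ((Γ a M).mkQ x) ∈ Γ a K :=
      (Submodule.Quotient.mk_eq_zero _).1 (congrArg Prod.snd hx)
    have h3 : x ∈ Γ a M := mem_Γ_of_mkQ_mem (mem_Γ_of_injective hk h2)
    have h4 := hf₁ ⟨x, h3⟩
    have h5 : j ⟨x, h3⟩ = j 0 := by
      rw [map_zero]
      exact congrArg Subtype.val (h4.symm.trans h1)
    exact congrArg Subtype.val (hj h5)
  · rintro ⟨x, y⟩ hxy
    have h1 : y ∈ Γ a (K ⧸ Γ a K) := map_mem_Γ (LinearMap.snd R (Γ b J) (K ⧸ Γ a K)) hxy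
    obtain ⟨y, rfl⟩ := (Γ a K).mkQ_surjective y
    have h2 : (Γ a K).mkQ y = 0 := (Submodule.Quotient.mk_eq_zero _).2 (mem_Γ_of_mkQ_mem h1)
    rw [h2]
    exact map_mem_Γ (LinearMap.inl R (Γ b J) (K ⧸ Γ a K))
      (mem_Γ_of_injective (Γ b J).injective_subtype x.2)

/-- Local cohomology does not change when the support ideal `a` is enlarged by an ideal `b` for
which `H^j_a(M)` is `b`-torsion in all degrees up to the one considered. -/
theorem exists_linearEquiv_H_sup [IsNoetherianRing R] (a b : Ideal R) (i : ℕ) (M : Type u)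
    [AddCommGroup M] [Module R M] (h : ∀ j ≤ i, ∀ x : H a j M, x ∈ Γ b (H a j M)) :
    Nonempty (H a i M ≃ₗ[R] H (a ⊔ b) i M) := by
  have hΓ {M : Type u} [AddCommGroup M] [Module R M] (h : ∀ x : H a 0 M, x ∈ Γ b (H a 0 M)) :
      Γ a M ≤ Γ b M := by
    obtain ⟨e⟩ := exists_linearEquiv_H_zero a (M := M)
    intro x hx
    have := map_mem_Γ ((Γ a M).subtype ∘ₗ e.toLinearMap) (h (e.symm ⟨x, hx⟩))
    simpa using this
  have hC {M I C : Type u} [AddCommGroup M] [Module R M] [AddCommGroup I] [Module R I]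
      [AddCommGroup C] [Module R C] [Module.Injective R I] {f : M →ₗ[R] I} {g : I →ₗ[R] C}
      (hf : Function.Injective f) (hg : Function.Surjective g) (hfg : Function.Exact f g)
      (hI : Γ a I ≤ Γ b I) (h : ∀ x : H a 1 M, x ∈ Γ b (H a 1 M)) : Γ a C ≤ Γ b C := by
    obtain ⟨γ, -, hex⟩ := exists_surjective_H_one a hf hg hfg
    intro y hy
    obtain ⟨n, hn⟩ := h (γ ⟨y, hy⟩)
    refine mem_Γ_of_forall_pow (n := n) fun r hr => ?_
    obtain ⟨z, hz⟩ := (hex (r • ⟨y, hy⟩)).1 (by rw [map_smul, hn r hr])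
    rw [show r • y = g z from (congrArg Subtype.val hz).symm]
    exact map_mem_Γ g (hI z.2)
  induction i using Nat.twoStepInduction generalizing M with
  | zero =>
    obtain ⟨e⟩ := exists_linearEquiv_H_zero a (M := M)
    obtain ⟨e'⟩ := exists_linearEquiv_H_zero (a ⊔ b) (M := M)
    exact ⟨e.trans ((LinearEquiv.ofEq _ _ (Γ_eq_Γ_sup (hΓ (h 0 le_rfl)))).trans e'.symm)⟩
  | one =>
    obtain ⟨I, _, _, f, _, hf, hI⟩ := exists_injective_embedding_Γ_le a b M
      (hΓ (h 0 (Nat.zero_le _)))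
    have hg := (LinearMap.range f).mkQ_surjective
    have hfg := LinearMap.exact_map_mkQ_range f
    have hΓI := Γ_eq_Γ_sup hI
    have hΓC := Γ_eq_Γ_sup (hC hf hg hfg hI (h 1 le_rfl))
    obtain ⟨γ, hγ, hex⟩ := exists_surjective_H_one a hf hg hfg
    obtain ⟨γ', hγ', hex'⟩ := exists_surjective_H_one (a ⊔ b) hf hg hfg
    have hker : LinearMap.ker γ = LinearMap.ker (γ' ∘ₗ (LinearEquiv.ofEq _ _ hΓC).toLinearMap) := by
      ext x
      simp only [LinearMap.mem_ker, LinearMap.coe_comp, Function.comp_apply, LinearEquiv.coe_coe]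
      rw [hex x, hex' _]
      constructor
      · rintro ⟨y, rfl⟩
        exact ⟨LinearEquiv.ofEq _ _ hΓI y, rfl⟩
      · rintro ⟨y, hy⟩
        have := congrArg Subtype.val hy
        exact ⟨(LinearEquiv.ofEq _ _ hΓI).symm y, Subtype.ext this⟩
    exact ⟨((LinearMap.quotKerEquivOfSurjective _ hγ).symm.trans
      (Submodule.quotEquivOfEq _ _ hker)).trans (LinearMap.quotKerEquivOfSurjective _
        (hγ'.comp (LinearEquiv.ofEq _ _ hΓC).surjective))⟩
  | more i _ ih =>
    obtain ⟨I, _, _, f, _, hf, hI⟩ := exists_injective_embedding_Γ_le a b M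
      (hΓ (h 0 (Nat.zero_le _)))
    have hg := (LinearMap.range f).mkQ_surjective
    have hfg := LinearMap.exact_map_mkQ_range f
    obtain ⟨e⟩ := exists_linearEquiv_H_add_two a hf hg hfg i
    obtain ⟨e'⟩ := exists_linearEquiv_H_add_two (a ⊔ b) hf hg hfg i
    obtain ⟨e''⟩ := ih (I ⧸ LinearMap.range f) (fun j hj x => by
      cases j with
      | zero =>
        obtain ⟨e₀⟩ := exists_linearEquiv_H_zero a (M := I ⧸ LinearMap.range f)
        refine mem_Γ_of_injective (f := (Γ a _).subtype ∘ₗ e₀.toLinearMap)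
          (Subtype.val_injective.comp e₀.injective) ?_
        exact hC hf hg hfg hI (h 1 (Nat.le_add_left 1 (i + 1))) (e₀ x).2
      | succ j =>
        obtain ⟨e₁⟩ := exists_linearEquiv_H_add_two a hf hg hfg j
        exact mem_Γ_of_injective (f := e₁.toLinearMap) e₁.injective
          (h (j + 2) (Nat.succ_le_succ hj) _))
    exact ⟨e.symm.trans (e''.trans e')⟩

end Injective

/-! ### From local to global annihilation -/

section LocalGlobal
variable {R : Type u} [CommRing R] {b : Ideal R}

/-- Being `b`-torsion is a local property of an element. -/
lemma mem_Γ_of_forall_prime [IsNoetherianRing R] {M : Type*} [AddCommGroup M] [Module R M] {x : M}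
    (h : ∀ p : PrimeSpectrum R, ∃ n : ℕ, ∀ r ∈ b ^ n, ∃ t ∈ p.asIdeal.primeCompl, t • r • x = 0) :
    x ∈ Γ b M := by
  by_contra hx
  have hne : (Γ b M).comap (LinearMap.toSpanSingleton R M x) ≠ (⊤ : Ideal R) := by
    rw [Ideal.ne_top_iff_one]
    simpa using hx
  obtain ⟨p, hp, hle⟩ := Ideal.exists_le_maximal _ hne
  obtain ⟨n, hn⟩ := h ⟨p, hp.isPrime⟩
  obtain ⟨t, ht, htx⟩ := exists_smul_eq_zero_of_ideal _ (IsNoetherian.noetherian (b ^ n)) x hn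
  exact ht (hle ⟨n, fun r hr => by
    rw [LinearMap.toSpanSingleton_apply, smul_comm, htx r hr]⟩)

/-- A minimax module which is locally killed by powers of `b` is killed by a power of `b`. -/
theorem IsMinimax.exists_pow_smul_eq_zero [IsNoetherianRing R] {L : Type u} [AddCommGroup L]
    [Module R L] (hL : IsMinimax R L)
    (h : ∀ p : PrimeSpectrum R, ∃ n : ℕ, ∀ r ∈ b ^ n, ∀ x : L,
      ∃ t ∈ p.asIdeal.primeCompl, t • r • x = 0) :
    ∃ n : ℕ, ∀ r ∈ b ^ n, ∀ x : L, r • x = 0 := by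
  obtain ⟨F, hF, hA⟩ := hL
  obtain ⟨m, hm⟩ := exists_pow_smul_eq_zero_of_fg (a := b) hF (fun x _ =>
    mem_Γ_of_forall_prime fun p => (h p).imp fun n hn r hr => hn r hr x)
  obtain ⟨n, hn⟩ := IsArtinian.monotone_stabilizes (R := R) (M := L ⧸ F)
    ⟨fun n => OrderDual.toDual (b ^ n • ⊤), fun i j hij =>
      Submodule.smul_mono_left (Ideal.pow_le_pow_right hij)⟩
  -- The stable value of `b ^ n A` on the Artinian quotient `A = L / F` vanishes at every prime.
  have hB : b ^ n • (⊤ : Submodule R (L ⧸ F)) = ⊥ := by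
    refine (Submodule.eq_bot_iff _).2 fun y hy => ?_
    by_contra hy0
    have hne : LinearMap.ker (LinearMap.toSpanSingleton R (L ⧸ F) y) ≠ (⊤ : Ideal R) := by
      rw [Ideal.ne_top_iff_one]
      simpa using hy0
    obtain ⟨p, hp, hle⟩ := Ideal.exists_le_maximal _ hne
    obtain ⟨k, hk⟩ := h ⟨p, hp.isPrime⟩
    have hyk : y ∈ b ^ k • (⊤ : Submodule R (L ⧸ F)) := by
      have h1 : b ^ n • (⊤ : Submodule R (L ⧸ F)) = b ^ max n k • ⊤ :=
        congrArg OrderDual.ofDual (hn (max n k) (le_max_left n k))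
      rw [h1] at hy
      exact Submodule.smul_mono_left (Ideal.pow_le_pow_right (le_max_right n k)) hy
    have key : ∃ t, t ∉ p ∧ t • y = 0 := by
      refine Submodule.smul_induction_on hyk (fun r hr x _ => ?_) ?_
      · obtain ⟨x, rfl⟩ := F.mkQ_surjective x
        obtain ⟨t, ht, htx⟩ := hk r hr x
        exact ⟨t, ht, by rw [← map_smul, ← map_smul, htx, map_zero]⟩
      · rintro x y ⟨s, hs, hsx⟩ ⟨t, ht, hty⟩
        refine ⟨s * t, fun hst => (hp.isPrime.mem_or_mem hst).elim hs ht, ?_⟩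
        rw [smul_add, mul_smul, mul_smul, hty, smul_comm, hsx, smul_zero, smul_zero, add_zero]
    obtain ⟨t, ht, hty⟩ := key
    exact ht (hle hty)
  refine ⟨m + n, fun r hr x => ?_⟩
  rw [pow_add] at hr
  have : b ^ m * b ^ n ≤ LinearMap.ker (LinearMap.toSpanSingleton R L x) :=
    Ideal.mul_le.2 fun s hs t ht => by
      rw [LinearMap.mem_ker, LinearMap.toSpanSingleton_apply, mul_smul]
      refine hm s hs _ ((Submodule.Quotient.mk_eq_zero F).1 ?_)
      rw [Submodule.Quotient.mk_smul, ← Submodule.mem_bot R, ← hB]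
      exact Submodule.smul_mem_smul ht trivial
  exact this hr

lemma le_radical_annihilator_iff [IsNoetherianRing R] {M : Type*} [AddCommGroup M] [Module R M] :
    b ≤ (Module.annihilator R M).radical ↔ ∃ n : ℕ, ∀ r ∈ b ^ n, ∀ x : M, r • x = 0 := by
  constructor
  · intro h
    obtain ⟨n, hn⟩ := Ideal.exists_pow_le_of_le_radical_of_fg h (IsNoetherian.noetherian b)
    exact ⟨n, fun r hr => Module.mem_annihilator.1 (hn hr)⟩
  · rintro ⟨n, hn⟩ r hr
    exact ⟨n, Module.mem_annihilator.2 (hn _ (Ideal.pow_mem_pow hr n))⟩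

lemma localizedModule_smul_eq_zero_iff (S : Submonoid R) {J : Ideal R} {M : Type*} [AddCommGroup M]
    [Module R M] :
    (∀ r ∈ J.map (algebraMap R (Localization S)), ∀ x : LocalizedModule S M, r • x = 0) ↔
      ∀ r ∈ J, ∀ x : M, ∃ t ∈ S, t • r • x = 0 := by
  constructor
  · intro h r hr x
    have := h _ (Ideal.mem_map_of_mem _ hr) (LocalizedModule.mk x 1)
    rwa [algebraMap_smul, LocalizedModule.smul'_mk, mk_eq_zero_iff] at this
  · intro h r hr x
    refine smul_eq_zero_of_mem_map (fun r hr => ?_) r hr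
    induction x using LocalizedModule.induction_on with
    | h m s =>
      rw [algebraMap_smul, LocalizedModule.smul'_mk, mk_eq_zero_iff]
      exact h r hr m

lemma smul_eq_zero_congr {A : Type*} [CommRing A] {J : Ideal A} {M N : Type*} [AddCommGroup M]
    [Module A M] [AddCommGroup N] [Module A N] (e : M ≃ₗ[A] N) :
    (∀ r ∈ J, ∀ x : M, r • x = 0) ↔ ∀ r ∈ J, ∀ x : N, r • x = 0 := by
  refine forall₂_congr fun r _ => ⟨fun h x => ?_, fun h x => ?_⟩
  · rw [← e.apply_symm_apply x, ← map_smul, h, map_zero]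
  · exact e.injective (by rw [map_smul, h, map_zero])

/-- Annihilation of the local cohomology of the localized module, read off before
localizing. -/
theorem localized_H_smul_eq_zero_iff [IsNoetherianRing R] (S : Submonoid R) (a b : Ideal R)
    (i n : ℕ) (M : Type u) [AddCommGroup M] [Module R M] :
    (∀ r ∈ locIdeal S b ^ n, ∀ x : H (locIdeal S a) i (LocalizedModule S M), r • x = 0) ↔
      ∀ r ∈ b ^ n, ∀ x : H a i M, ∃ t ∈ S, t • r • x = 0 := by
  obtain ⟨e⟩ := exists_linearEquiv_localizedModule_H S a i M
  rw [← smul_eq_zero_congr e, ← Ideal.map_pow]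
  exact localizedModule_smul_eq_zero_iff S

lemma natCast_lt_sInf_iff (P : ℕ → Prop) (r : ℕ) :
    (r : ℕ∞) < sInf {d : ℕ∞ | ∃ i : ℕ, d = i ∧ P i} ↔ ∀ i ≤ r, ¬ P i := by
  constructor
  · intro h i hi hP
    exact (h.trans_le (sInf_le ⟨i, rfl, hP⟩)).not_ge (Nat.cast_le.2 hi)
  · intro h
    by_contra hlt
    rw [not_lt] at hlt
    rcases Set.eq_empty_or_nonempty {d : ℕ∞ | ∃ i : ℕ, d = i ∧ P i} with he | hne
    · rw [he, sInf_empty] at hlt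
      exact (ENat.natCast_lt_top r).not_ge hlt
    · obtain ⟨i, hi, hP⟩ := csInf_mem hne
      rw [hi] at hlt
      exact h i (Nat.cast_le.1 hlt) hP

lemma lt_finitenessDim_iff [IsNoetherianRing R] (a b : Ideal R) (M : Type u) [AddCommGroup M]
    [Module R M] (r : ℕ) : (r : ℕ∞) < finitenessDim a b M ↔
      ∀ i ≤ r, ∃ n : ℕ, ∀ s ∈ b ^ n, ∀ x : H a i M, s • x = 0 := by
  rw [finitenessDim, natCast_lt_sInf_iff]
  simp only [not_not, le_radical_annihilator_iff]

lemma lt_minimaxDim_iff (a b : Ideal R) (M : Type u) [AddCommGroup M]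
    [Module R M] (r : ℕ) : (r : ℕ∞) < minimaxDim a b M ↔
      ∀ i ≤ r, 1 ≤ i → ∃ t : ℕ, 1 ≤ t ∧
        IsMinimax R ↥(b ^ t • (⊤ : Submodule R (H a i M))) := by
  rw [minimaxDim, natCast_lt_sInf_iff]
  simp only [not_and, not_forall, not_not, exists_prop]

lemma lt_minimaxDim_of_lt_finitenessDim [IsNoetherianRing R] {a b : Ideal R} {M : Type u}
    [AddCommGroup M] [Module R M] {r : ℕ} (h : (r : ℕ∞) < finitenessDim a b M) :
    (r : ℕ∞) < minimaxDim a b M := by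
  rw [lt_finitenessDim_iff] at h
  rw [lt_minimaxDim_iff]
  intro i hi _
  obtain ⟨n, hn⟩ := h i hi
  have hbot : b ^ (n + 1) • (⊤ : Submodule R (H a i M)) = ⊥ :=
    le_bot_iff.1 (Submodule.smul_le.2 fun s hs x _ =>
      hn s (Ideal.pow_le_pow_right n.le_succ hs) x)
  refine ⟨n + 1, Nat.le_add_left 1 n, ⊥, Submodule.fg_bot, ?_⟩
  have : Subsingleton ↥(b ^ (n + 1) • (⊤ : Submodule R (H a i M))) :=
    Submodule.subsingleton_iff_eq_bot.2 hbot
  infer_instance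

lemma isMinimax_H_zero [IsNoetherianRing R] (a : Ideal R) (M : Type u) [AddCommGroup M]
    [Module R M] [Module.Finite R M] : IsMinimax R (H a 0 M) := by
  obtain ⟨e⟩ := exists_linearEquiv_H_zero a (M := M)
  have : Module.Finite R (H a 0 M) := Module.Finite.equiv e.symm
  exact ⟨⊤, Module.Finite.fg_top, inferInstance⟩

end LocalGlobal

end MinimaxLC

open MinimaxLC in
theorem proposition3p1 (R : Type u) [CommRing R] [IsNoetherianRing R] (r : ℕ)
    (h : MinimaxLC.MinimaxPrinciple R r) : MinimaxLC.AnnihilationPrinciple R r := by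
  intro a b M _ _ _
  constructor
  · intro hloc
    have hloc' (p : PrimeSpectrum R) (i : ℕ) (hi : i ≤ r) : ∃ n : ℕ, ∀ s ∈ b ^ n,
        ∀ x : H a i M, ∃ t ∈ p.asIdeal.primeCompl, t • s • x = 0 :=
      ((lt_finitenessDim_iff _ _ _ r).1 (hloc p) i hi).imp fun n hn =>
        (localized_H_smul_eq_zero_iff _ a b i n M).1 hn
    have htors (i : ℕ) (hi : i ≤ r) (x : H a i M) : x ∈ Γ b (H a i M) :=
      mem_Γ_of_forall_prime fun p => (hloc' p i hi).imp fun n hn s hs => hn s hs x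
    have hequiv (i : ℕ) (hi : i ≤ r) : Nonempty (H a i M ≃ₗ[R] H (a ⊔ b) i M) :=
      exists_linearEquiv_H_sup a b i M fun j hj => htors j (hj.trans hi)
    have hloc'' (p : PrimeSpectrum R) (i : ℕ) (hi : i ≤ r) : ∃ n : ℕ, ∀ s ∈ b ^ n,
        ∀ x : H (a ⊔ b) i M, ∃ t ∈ p.asIdeal.primeCompl, t • s • x = 0 := by
      obtain ⟨n, hn⟩ := hloc' p i hi
      obtain ⟨e⟩ := hequiv i hi
      refine ⟨n, fun s hs x => ?_⟩
      obtain ⟨x, rfl⟩ := e.surjective x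
      obtain ⟨t, ht, htx⟩ := hn s hs x
      exact ⟨t, ht, by rw [← map_smul, ← map_smul, htx, map_zero]⟩
    -- `b ≤ a ⊔ b`, so the minimaxness principle applies to the enlarged support ideal.
    have hμ := (h (a ⊔ b) b le_sup_right M).1 fun p => by
      refine lt_minimaxDim_of_lt_finitenessDim ((lt_finitenessDim_iff _ _ _ r).2 fun i hi => ?_)
      exact (hloc'' p i hi).imp fun n hn => (localized_H_smul_eq_zero_iff _ (a ⊔ b) b i n M).2 hn
    rw [lt_minimaxDim_iff] at hμ
    rw [lt_finitenessDim_iff]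
    intro i hi
    obtain ⟨e⟩ := hequiv i hi
    suffices ∃ n : ℕ, ∀ s ∈ b ^ n, ∀ x : H (a ⊔ b) i M, s • x = 0 from
      this.imp fun n hn => (smul_eq_zero_congr e).2 hn
    rcases Nat.eq_zero_or_pos i with rfl | hi1
    · exact (isMinimax_H_zero (a ⊔ b) M).exists_pow_smul_eq_zero fun p => hloc'' p 0 hi
    · obtain ⟨t, -, ht⟩ := hμ i hi hi1
      obtain ⟨n, hn⟩ := ht.exists_pow_smul_eq_zero (b := b) fun p =>
        (hloc'' p i hi).imp fun n hn s hs x =>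
          (hn s hs x.1).imp fun t ht => ⟨ht.1, Subtype.ext ht.2⟩
      refine ⟨n + t, fun s hs x => ?_⟩
      rw [pow_add] at hs
      have : b ^ n * b ^ t ≤ LinearMap.ker (LinearMap.toSpanSingleton R _ x) :=
        Ideal.mul_le.2 fun c hc d hd => by
          rw [LinearMap.mem_ker, LinearMap.toSpanSingleton_apply, mul_smul]
          exact congrArg Subtype.val (hn c hc ⟨d • x, Submodule.smul_mem_smul hd trivial⟩)
      exact this hs
  · intro hglob p
    rw [lt_finitenessDim_iff] at hglob ⊢
    intro i hi
    obtain ⟨n, hn⟩ := hglob i hi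
    exact ⟨n, (localized_H_smul_eq_zero_iff _ a b i n M).2 fun s hs x =>
      ⟨1, one_mem _, by rw [hn s hs x, smul_zero]⟩⟩
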